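/- **Theorem 2.8.** For a set $A$ let $\mathcal P^*(A)$ be the set of its non-empty subsets. For a finite group $G$, a positive integer $n$ and $L\in\mathcal P^*(G)$ let $N_{n,L}$ be the set of all $S\in\mathcal P^*(G)$ with $\{s^n \mid s\in S\}=L$. Let $\mathcal D$ be the class of the finite groups $G$ such that $|N_{n,L}|$ divides $|\mathcal P^*(G)|^{|L|}$ for all $n\ge 1$ and $L\in\mathcal P^*(G)$ with $|N_{n,L}|\neq 0$. A finite $p$-group $G$ ($p$ prime) is called extraspecial if it has nilpotency class $2$, $G'=Z(G)=\Phi(G)$ and $|G'|=p$. For odd $p$ let $$M_{p^3}=\langle x,y\mid x^{p^2}=y^p=1,\ y^{-1}xy=x^{p+1}\rangle,\qquad He_p=\langle x,y,z\mid x^p=y^p=z^p=1,\ [x,z]=[y,z]=1,\ [x,y]=z\rangle,$$ and let $H^{\circ k}$ denote the central product of $k$ copies of $H$ with joint centers, that is, the quotient of $H^k$ by $\{(z_1,\dots,z_k)\in Z(H)^k \mid z_1\cdots z_k=1\}$. Let $G$ be an extraspecial $p$-group, and let $V(G)=\{|N_{n,L}| \,:\, n\ge 1,\ L\in\mathcal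 P^*(G)\}$ be the set of all values of $|N_{n,L}|$. a) Assume that $p$ is odd, and let $k\geq 1$ be an integer. i) If $G\cong M_{p^3}^{\circ k}$, then $V(G)=\{0,\,1,\,2^{p^{2k+1}}-1\}\cup\{(2^{p^{2k}}-1)^j \mid 1\le j\le p\}$. ii) If $G\cong He_p^{\circ k}$, then $V(G)=\{0,\,1,\,2^{p^{2k+1}}-1\}$. Moreover, every extraspecial $p$-group $G$ with $p$ odd belongs to $\mathcal D$. b) Assume that $p=2$. Then there is an integer $k\ge 1$ with $|G|=2^{2k+1}$, and $$V(G)=\{0,\,1,\,2^{4^k-2^k}-1,\,2^{4^k+2^k}-1,\,(2^{4^k-2^k}-1)(2^{4^k+2^k}-1),\,2^{2^{2k+1}}-1\}.$$ Moreover, $G\notin\mathcal D$. -/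

import Mathlib

/-- A finite `p`-group `G` is extraspecial if it has nilpotency class exactly `2`,
`G' = Z(G) = Φ(G)` and `|G'| = p`. -/
structure IsExtraspecial (p : ℕ) (G : Type*) [Group G] : Prop where
  finite : Finite G
  isPGroup : IsPGroup p G
  class_eq_two : Group.nilpotencyClass G = 2
  commutator_eq_center : commutator G = Subgroup.center G
  center_eq_frattini : Subgroup.center G = frattini G
  card_commutator : Nat.card (commutator G) = p

open scoped IsMulCommutative in
/-- The subgroup of `H ^ k` of all tuples `(z₁, …, z_k)` of central elements of `H` with
`z₁ ⋯ z_k = 1`. -/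
def centralKernel (H : Type*) [Group H] (k : ℕ) : Subgroup (Fin k → H) where
  carrier := {f | ∃ z : Fin k → Subgroup.center H, (∀ i, f i = z i) ∧ ∏ i, z i = 1}
  one_mem' := ⟨1, fun _ => rfl, by simp⟩
  mul_mem' := by
    rintro f g ⟨z, hz, hz1⟩ ⟨w, hw, hw1⟩
    refine ⟨z * w, fun i => by simp [hz, hw], ?_⟩
    simp [Finset.prod_mul_distrib, hz1, hw1]
  inv_mem' := by
    rintro f ⟨z, hz, hz1⟩
    refine ⟨z⁻¹, fun i => by simp [hz], ?_⟩
    simp [hz1]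

open scoped IsMulCommutative in
instance centralKernel_normal (H : Type*) [Group H] (k : ℕ) : (centralKernel H k).Normal where
  conj_mem := by
    rintro f ⟨z, hz, hz1⟩ g
    refine ⟨z, fun i => ?_, hz1⟩
    have h := Subgroup.mem_center_iff.mp (z i).2 (g i)
    simp only [Pi.mul_apply, Pi.inv_apply, hz, h, mul_inv_cancel_right]

/-- The central product `H ∘ ⋯ ∘ H` of `k` copies of `H` with joint centers: the direct product
`H ^ k` in which the centers of the `k` factors are identified with each other. It is trivial
for `k = 0` and isomorphic to `H` for `k = 1`. -/
abbrev CentralPower (H : Type*) [Group H] (k : ℕ) : Type _ :=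
  (Fin k → H) ⧸ centralKernel H k

open FreeGroup in
/-- The modular `p`-group of order `p ^ 3` (`p` odd),
`⟨x, y ∣ x ^ (p ^ 2) = y ^ p = 1, y⁻¹ x y = x ^ (p + 1)⟩`, with `x = of 0` and `y = of 1`. -/
abbrev ModularGroupCube (p : ℕ) : Type :=
  PresentedGroup
    ({of 0 ^ (p ^ 2), of 1 ^ p, (of 1)⁻¹ * of 0 * of 1 * (of 0 ^ (p + 1))⁻¹} :
      Set (FreeGroup (Fin 2)))

open FreeGroup in
open scoped commutatorElement in
/-- The Heisenberg group of order `p ^ 3` (`p` odd),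
`⟨x, y, z ∣ x ^ p = y ^ p = z ^ p = 1, [x, z] = [y, z] = 1, [x, y] = z⟩`, with
`x = of 0`, `y = of 1` and `z = of 2`. -/
abbrev HeisenbergGroup (p : ℕ) : Type :=
  PresentedGroup
    ({of 0 ^ p, of 1 ^ p, of 2 ^ p, ⁅of (0 : Fin 3), of (2 : Fin 3)⁆,
      ⁅of (1 : Fin 3), of (2 : Fin 3)⁆, ⁅of (0 : Fin 3), of (1 : Fin 3)⁆ * (of 2)⁻¹} :
      Set (FreeGroup (Fin 3)))

/-- The set of all non-empty subsets of `G`. -/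
def nonemptySubsets (G : Type*) : Set (Set G) := {S | S.Nonempty}

/-- The set `N_{n, L}` of the non-empty subsets `S` of `G` with `{s ^ n ∣ s ∈ S} = L`. -/
def powerSolutions {G : Type*} [Group G] (n : ℕ) (L : Set G) : Set (Set G) :=
  {S | S ∈ nonemptySubsets G ∧ (fun s => s ^ n) '' S = L}

/-- The set of all values `|N_{n, L}|`, for `n` a positive integer and `L` a non-empty subset
of `G`. -/
def solutionCounts (G : Type*) [Group G] : Set ℕ :=
  {m | ∃ n : ℕ, 0 < n ∧ ∃ L ∈ nonemptySubsets G, (powerSolutions n L).ncard = m}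

/-- Membership of a finite group in the class `𝒟`: whenever `n` is a positive integer, `L` is a
non-empty subset of `G` and `|N_{n, L}| ≠ 0`, the number `|N_{n, L}|` divides `|P*(G)| ^ |L|`. -/
def InClassD (G : Type*) [Group G] : Prop :=
  Finite G ∧ ∀ n : ℕ, 0 < n → ∀ L ∈ nonemptySubsets G, (powerSolutions n L).ncard ≠ 0 →
    (powerSolutions n L).ncard ∣ (nonemptySubsets G).ncard ^ L.ncard

open scoped commutatorElement

/-! ### Groups whose commutators are central -/

/-! A set `S` with `{s ^ n ∣ s ∈ S} = L` amounts to a non-empty subset of each fibre of the `n`-th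
power map over `L`, so `|N_{n,L}|` is the product over `l ∈ L` of `2 ^ a - 1`, with `a` the size of
the fibre over `l` (`ncard_setOf_image_eq`). Only the fibres of power maps matter. In an
extraspecial group `p`-th powers are central and `x ^ (p * p) = 1`; if `p ∤ n` the power map is a
bijection and the count is `1`.

For odd `p` and `p ∣ n` the power map is an endomorphism into the center, of order `p`. Its image is
trivial or the whole center and its fibres are cosets of the kernel, so `V(G)` depends only on `|G|`
and on whether `G` has exponent `p`. Membership in `𝒟` follows from Lagrange and `2 ^ a - 1 ∣ 2 ^ b
- 1` for `a ∣ b`. For the central powers, the relations only bound the order of a factor by `p ^ 3`;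
non-commutativity, forced by that of `G`, makes the bound sharp.

For `p = 2` squaring is not a homomorphism. Its fibres over `1` and the central involution `z` have
sizes `A`, `B` with `A + B = |G|`, and a Gauss sum argument gives `(A - B) ^ 2 = 2 * |G|`
(`sq_sum_centralSign_sq`). The larger fibre violates the divisibility (`not_dvd_of_two`). -/

theorem mul_pow_of_central_swap {G : Type*} [Group G] {x y c : G} (hc : c ∈ Subgroup.center G)
    (h : y * x = c * (x * y)) (n : ℕ) : (x * y) ^ n = c ^ n.choose 2 * (x ^ n * y ^ n) := by
  have hcg : ∀ (m : ℕ) (g : G), g * c ^ m = c ^ m * g := fun m g =>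
    Subgroup.mem_center_iff.mp (pow_mem hc m) g
  have hswap : ∀ m : ℕ, y ^ m * x = c ^ m * (x * y ^ m) := by
    intro m
    induction m with
    | zero => simp
    | succ m ih =>
      calc y ^ (m + 1) * x = y ^ m * (y * x) := by rw [pow_succ, mul_assoc]
        _ = c * (y ^ m * x) * y := by
          rw [h, ← mul_assoc, Subgroup.mem_center_iff.mp hc]; simp only [mul_assoc]
        _ = c ^ (m + 1) * (x * y ^ (m + 1)) := by
          rw [ih, pow_succ' c, pow_succ y]; simp only [mul_assoc]
  induction n with
  | zero => simp
  | succ n ih =>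
    calc (x * y) ^ (n + 1) = c ^ n.choose 2 * (x ^ n * (y ^ n * x) * y) := by
          rw [pow_succ, ih]; simp only [mul_assoc]
      _ = c ^ n.choose 2 * ((x ^ n * c ^ n) * (x * y ^ n * y)) := by
          rw [hswap]; simp only [mul_assoc]
      _ = c ^ (n + 1).choose 2 * (x ^ (n + 1) * y ^ (n + 1)) := by
          rw [hcg, Nat.choose_succ_succ' n 1, Nat.choose_one_right, add_comm n, pow_add,
            pow_succ x, pow_succ y]
          simp only [mul_assoc]

/-- The commutator enters with exponent `p.choose 2`, a multiple of `p` when `p` is odd. -/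
theorem mul_pow_odd_of_commutator {G : Type*} [Group G] {p : ℕ} (hp : Odd p)
    (hc : ∀ x y : G, ⁅x, y⁆ ∈ Subgroup.center G) (h1 : ∀ x y : G, ⁅x, y⁆ ^ p = 1) (x y : G) :
    (x * y) ^ p = x ^ p * y ^ p := by
  rw [mul_pow_of_central_swap (hc y x) (by simp [commutatorElement_def, mul_assoc])]
  obtain ⟨m, rfl⟩ := hp
  have : (2 * m + 1).choose 2 = (2 * m + 1) * m := by
    rw [Nat.choose_two_right, Nat.add_sub_cancel, mul_left_comm, Nat.mul_div_cancel_left _ two_pos]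
  rw [this, pow_mul, h1, one_pow, one_mul]

/-- A non-commutative `p`-group of order at most `p ^ 3` has
order exactly `p ^ 3` and a center of order `p`. -/
theorem card_and_card_center_of_card_le_cube {H : Type*} [Group H] [Finite H] {p : ℕ}
    (hp : p.Prime) (hH : IsPGroup p H) (hle : Nat.card H ≤ p ^ 3)
    (hnc : ¬ ∀ a b : H, a * b = b * a) :
    Nat.card H = p ^ 3 ∧ Nat.card (Subgroup.center H) = p := by
  have := Fact.mk hp
  obtain ⟨m, hm⟩ := IsPGroup.iff_card.mp hH
  have hm3 : m ≤ 3 := by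
    rw [hm] at hle
    exact (Nat.pow_le_pow_iff_right hp.one_lt).mp hle
  have hm' : m = 3 := by
    interval_cases m
    · have := (Nat.card_eq_one_iff_unique.mp (by simpa using hm)).1
      exact (hnc fun a b => Subsingleton.elim _ _).elim
    · have := isCyclic_of_prime_card (hm.trans (pow_one p))
      exact (hnc fun a b => (IsCyclic.isMulCommutative (α := H)).is_comm.comm a b).elim
    · exact (hnc (IsPGroup.isMulCommutative_of_card_eq_prime_sq hm).is_comm.comm).elim
    · rfl
  subst hm'
  refine ⟨hm, ?_⟩
  obtain ⟨j, hj0, hj⟩ := IsPGroup.card_center_eq_prime_pow hm (by norm_num)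
  have hidx := Subgroup.card_mul_index (Subgroup.center H)
  have hjle : j ≤ 3 := by
    have := Subgroup.card_le_card_group (Subgroup.center H)
    rw [hj, hm] at this
    exact (Nat.pow_le_pow_iff_right hp.one_lt).mp this
  -- A group with cyclic central quotient is commutative; this excludes centers of order `p ^ 2` and
  -- `p ^ 3`.
  have hcyc : ¬ IsCyclic (H ⧸ Subgroup.center H) := fun h => hnc <| by
    have := MonoidHom.isMulCommutative_of_isCyclic_of_ker_le_center
      (QuotientGroup.mk' (Subgroup.center H)) (by simp)
    exact this.is_comm.comm
  rw [hj, hm, Subgroup.index_eq_card] at hidx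
  have hpos : ∀ i, 0 < p ^ i := fun i => pow_pos hp.pos i
  interval_cases j
  · rw [hj, pow_one]
  · refine (hcyc (isCyclic_of_prime_card (p := p) ?_)).elim
    exact Nat.eq_of_mul_eq_mul_left (hpos 2) (by rw [hidx]; ring)
  · have h1 : Nat.card (H ⧸ Subgroup.center H) = 1 :=
      Nat.eq_of_mul_eq_mul_left (hpos 3) (by rw [hidx]; ring)
    have := (Nat.card_eq_one_iff_unique.mp h1).1
    exact (hcyc inferInstance).elim

/-! ### Groups generated by `x`, `y` and a central `z` with `x * y = z * (y * x)` -/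

section TwoGenerators

variable {H : Type*} [Group H] {x y z : H}

theorem mem_center_of_closure_eq_top {s : Set H} (hs : Subgroup.closure s = ⊤)
    (h : ∀ g ∈ s, g * z = z * g) : z ∈ Subgroup.center H := by
  rw [Subgroup.mem_center_iff]
  intro g
  have : Subgroup.closure s ≤ Subgroup.centralizer {z} := by
    rw [Subgroup.closure_le]
    intro g hg
    rw [SetLike.mem_coe, Subgroup.mem_centralizer_singleton_iff]
    exact h g hg
  have hg : g ∈ Subgroup.centralizer {z} := this (hs ▸ Subgroup.mem_top g)
  exact Subgroup.mem_centralizer_singleton_iff.mp hg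

/-- Modulo the central subgroup generated by `z` the generators commute, so the quotient is
commutative. -/
theorem commutator_mem_zpowers (hz : z ∈ Subgroup.center H) (hxy : x * y = z * (y * x))
    (hgen : Subgroup.closure {x, y, z} = ⊤) (g h : H) : ⁅g, h⁆ ∈ Subgroup.zpowers z := by
  have hle : Subgroup.zpowers z ≤ Subgroup.center H := by simpa using hz
  have : (Subgroup.zpowers z).Normal := ⟨fun n hn g => by
    rw [Subgroup.mem_center_iff.mp (hle hn) g, mul_inv_cancel_right]; exact hn⟩
  let f := QuotientGroup.mk' (Subgroup.zpowers z)
  have hfz : f z = 1 := (QuotientGroup.eq_one_iff z).mpr (Subgroup.mem_zpowers z)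
  have hfxy : f x * f y = f y * f x := by
    rw [← map_mul, hxy, map_mul, hfz, one_mul, map_mul]
  have hcl : Subgroup.closure {f x, f y, f z} = ⊤ := by
    have := congrArg (Subgroup.map f) hgen
    rw [MonoidHom.map_closure, Subgroup.map_top_of_surjective f
      (QuotientGroup.mk'_surjective _)] at this
    simpa [Set.image_insert_eq] using this
  have hcomm := Subgroup.isMulCommutative_closure (k := {f x, f y, f z}) (by
    simp only [Set.mem_insert_iff, Set.mem_singleton_iff, hfz]
    rintro a (rfl | rfl | rfl) b (rfl | rfl | rfl) <;> simp [hfxy])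
  have := hcomm.is_comm.comm ⟨f g, hcl ▸ Subgroup.mem_top _⟩ ⟨f h, hcl ▸ Subgroup.mem_top _⟩
  have h2 : f g * f h = f h * f g := congrArg Subtype.val this
  rw [← QuotientGroup.eq_one_iff]
  change f ⁅g, h⁆ = 1
  rw [map_commutatorElement, commutatorElement_eq_one_iff_mul_comm, h2]

theorem zpow_swap_of_central (hz : z ∈ Subgroup.center H) (hxy : x * y = z * (y * x)) (a : ℤ) :
    y * x ^ a = z ^ (-a) * (x ^ a * y) := by
  have h1 : y * x * y⁻¹ = z⁻¹ * x := by
    rw [eq_inv_mul_iff_mul_eq, ← mul_assoc, ← hxy, mul_inv_cancel_right]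
  have h2 : y * x ^ a * y⁻¹ = z⁻¹ ^ a * x ^ a := by
    rw [← conj_zpow, h1]
    exact Commute.mul_zpow (Subgroup.mem_center_iff.mp (inv_mem hz) x).symm a
  rw [inv_zpow', mul_inv_eq_iff_eq_mul] at h2
  rw [h2, mul_assoc]

/-- Products of this shape are stable under left multiplication by each generator and its inverse.
-/
theorem exists_zpow_normal_form (hz : z ∈ Subgroup.center H) (hxy : x * y = z * (y * x))
    (hgen : Subgroup.closure {x, y, z} = ⊤) (g : H) :
    ∃ a b c : ℤ, g = z ^ c * (x ^ a * y ^ b) := by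
  have hzc : ∀ (n : ℤ) (g : H), g * z ^ n = z ^ n * g := fun n g =>
    Subgroup.mem_center_iff.mp (zpow_mem hz n) g
  have hg : g ∈ Subgroup.closure {x, y, z} := hgen ▸ Subgroup.mem_top g
  have hx : ∀ n a b c : ℤ, x ^ n * (z ^ c * (x ^ a * y ^ b)) = z ^ c * (x ^ (n + a) * y ^ b) :=
    fun n a b c => by rw [← mul_assoc, hzc, zpow_add]; simp only [mul_assoc]
  have hy : ∀ a b c : ℤ, y * (z ^ c * (x ^ a * y ^ b)) = z ^ (c + -a) * (x ^ a * y ^ (1 + b)) :=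
    fun a b c => by
      rw [← mul_assoc, hzc, mul_assoc, ← mul_assoc y, zpow_swap_of_central hz hxy, zpow_add,
        zpow_one_add]
      simp only [mul_assoc]
  induction hg using Subgroup.closure_induction_left with
  | one => exact ⟨0, 0, 0, by simp⟩
  | mul_left s hs g hg ih =>
    obtain ⟨a, b, c, rfl⟩ := ih
    rcases hs with rfl | rfl | rfl
    · exact ⟨1 + a, b, c, by rw [← hx, zpow_one]⟩
    · exact ⟨a, 1 + b, c + -a, hy a b c⟩
    · exact ⟨a, b, 1 + c, by rw [zpow_one_add, mul_assoc]⟩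
  | inv_mul_cancel s hs g hg ih =>
    obtain ⟨a, b, c, rfl⟩ := ih
    rcases hs with rfl | rfl | rfl
    · exact ⟨-1 + a, b, c, by rw [← hx, zpow_neg_one]⟩
    · refine ⟨a, -1 + b, c + a, ?_⟩
      rw [inv_mul_eq_iff_eq_mul, hy, add_neg_cancel_right, add_neg_cancel_left]
    · exact ⟨a, b, -1 + c, by rw [zpow_add, zpow_neg_one, mul_assoc]⟩

theorem pow_eq_one_of_generators {n : ℕ} (hmul : ∀ g h : H, (g * h) ^ n = g ^ n * h ^ n)
    (hgen : Subgroup.closure {x, y, z} = ⊤) (hx : x ^ n = 1) (hy : y ^ n = 1) (hz : z ^ n = 1)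
    (g : H) : g ^ n = 1 := by
  let f : H →* H := MonoidHom.mk' (· ^ n) hmul
  have hle : Subgroup.closure {x, y, z} ≤ f.ker := by
    rw [Subgroup.closure_le]
    rintro s (rfl | rfl | rfl)
    exacts [hx, hy, hz]
  exact hle (hgen ▸ Subgroup.mem_top g)

theorem card_le_cube_of_generators {p : ℕ} (hp : 0 < p) (hz : z ∈ Subgroup.center H)
    (hxy : x * y = z * (y * x)) (hgen : Subgroup.closure {x, y, z} = ⊤) (hzp : z ^ p = 1)
    (hyp : y ^ p = 1) (hxp : x ^ p ∈ Subgroup.zpowers z) : Finite H ∧ Nat.card H ≤ p ^ 3 := by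
  have hp0 : (p : ℤ) ≠ 0 := by exact_mod_cast hp.ne'
  have hmod : ∀ (a : ℤ), 0 ≤ a % p ∧ a % p < p := fun a =>
    ⟨Int.emod_nonneg a hp0, Int.emod_lt_of_pos a (by exact_mod_cast hp)⟩
  have hred : ∀ (g : H), g ^ p = 1 → ∀ a : ℤ, ∃ i : Fin p, g ^ a = g ^ (i : ℕ) := by
    intro g hg a
    refine ⟨⟨(a % p).toNat, by have := hmod a; omega⟩, ?_⟩
    rw [← zpow_natCast, Int.toNat_of_nonneg (hmod a).1]
    conv_lhs => rw [← Int.emod_add_mul_ediv a p, zpow_add, zpow_mul, zpow_natCast, hg, one_zpow,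
      mul_one]
  obtain ⟨e, he⟩ := hxp
  have he : z ^ e = x ^ p := he
  have hsurj : Function.Surjective
      (fun t : Fin p × Fin p × Fin p => z ^ (t.1 : ℕ) * (x ^ (t.2.1 : ℕ) * y ^ (t.2.2 : ℕ))) := by
    intro g
    obtain ⟨a, b, c, rfl⟩ := exists_zpow_normal_form hz hxy hgen g
    obtain ⟨j, hj⟩ := hred y hyp b
    -- Reducing `a` modulo `p` splits off `(x ^ p) ^ (a / p) = z ^ (e * (a / p))`, which joins the
    -- power of `z`.
    obtain ⟨k, hk⟩ := hred z hzp (c + e * (a / p))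
    refine ⟨⟨k, ⟨(a % p).toNat, by have := hmod a; omega⟩, j⟩, ?_⟩
    dsimp only
    rw [← hj, ← hk, ← zpow_natCast x, Int.toNat_of_nonneg (hmod a).1]
    conv_rhs => rw [← Int.mul_ediv_add_emod a p, zpow_add, zpow_mul x, zpow_natCast, ← he,
      ← zpow_mul]
    rw [zpow_add]
    simp only [mul_assoc]
  refine ⟨Finite.of_surjective _ hsurj, (Nat.card_le_card_of_surjective _ hsurj).trans ?_⟩
  simp [pow_succ, mul_assoc]

theorem mul_pow_of_generators {p : ℕ} (hp : Odd p) (hz : z ∈ Subgroup.center H)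
    (hxy : x * y = z * (y * x)) (hgen : Subgroup.closure {x, y, z} = ⊤) (hzp : z ^ p = 1)
    (g h : H) : (g * h) ^ p = g ^ p * h ^ p := by
  have hle : Subgroup.zpowers z ≤ Subgroup.center H := by simpa using hz
  refine mul_pow_odd_of_commutator hp
    (fun a b => hle (commutator_mem_zpowers hz hxy hgen a b)) (fun a b => ?_) g h
  obtain ⟨e, he⟩ := commutator_mem_zpowers hz hxy hgen a b
  have he : z ^ e = ⁅a, b⁆ := he
  rw [← he, ← zpow_natCast, zpow_comm, zpow_natCast, hzp, one_zpow]

/-- The relations give only an upper bound on the order; `hnc` takes the place of an explicit model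
of the group. -/
theorem card_and_card_center_of_generators {p : ℕ} (hp : p.Prime) (hodd : Odd p)
    (hz : z ∈ Subgroup.center H) (hxy : x * y = z * (y * x))
    (hgen : Subgroup.closure {x, y, z} = ⊤) (hzp : z ^ p = 1) (hyp : y ^ p = 1)
    (hxp : x ^ p ∈ Subgroup.zpowers z) (hnc : ¬ ∀ a b : H, a * b = b * a) :
    Finite H ∧ Nat.card H = p ^ 3 ∧ Nat.card (Subgroup.center H) = p := by
  obtain ⟨hfin, hcard⟩ := card_le_cube_of_generators hp.pos hz hxy hgen hzp hyp hxp
  refine ⟨hfin, card_and_card_center_of_card_le_cube hp ?_ hcard hnc⟩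
  have hmul := mul_pow_of_generators hodd hz hxy hgen hzp
  rw [isPGroup_iff_pow_pow_eq_one]
  refine fun g => ⟨2, ?_⟩
  obtain ⟨e, he⟩ := hxp
  have he : z ^ e = x ^ p := he
  refine pow_eq_one_of_generators (x := x) (y := y) (z := z) ?_ hgen ?_ ?_ ?_ g
  · intro g h
    rw [sq, pow_mul, hmul, hmul, ← pow_mul, ← pow_mul]
  · rw [sq, pow_mul, ← he, ← zpow_natCast, zpow_comm, zpow_natCast, hzp, one_zpow]
  · rw [sq, pow_mul, hyp, one_pow]
  · rw [sq, pow_mul, hzp, one_pow]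

end TwoGenerators

/-! ### Central powers and the two presented groups of order `p ^ 3` -/

-- The subgroup is the kernel of the product map `Z(H) ^ k → Z(H)`, which is onto because `k ≥ 1`.
open scoped IsMulCommutative in
theorem card_centralKernel_mul_card_center (H : Type*) [Group H] [Finite H] {k : ℕ} (hk : 1 ≤ k) :
    Nat.card (centralKernel H k) * Nat.card (Subgroup.center H) =
      Nat.card (Subgroup.center H) ^ k := by
  let f : (Fin k → Subgroup.center H) →* Subgroup.center H :=
    MonoidHom.mk' (fun z => ∏ i, z i) fun a b => by simp [Finset.prod_mul_distrib]
  have hf : Function.Surjective f := fun z =>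
    ⟨Pi.mulSingle ⟨0, hk⟩ z, by simp [f, MonoidHom.mk']⟩
  let e : f.ker ≃ centralKernel H k := Equiv.ofBijective
    (fun z => ⟨fun i => z.1 i, z.1, fun _ => rfl, z.2⟩)
    ⟨fun z w h => Subtype.ext <| funext fun i => Subtype.ext (congrFun (congrArg Subtype.val h) i),
      fun ⟨g, z, hz, hz1⟩ => ⟨⟨z, hz1⟩, Subtype.ext (funext fun i => (hz i).symm)⟩⟩
  have hrange : Nat.card (Subgroup.center H) = f.ker.index := by
    rw [Subgroup.index_ker, MonoidHom.range_eq_top.mpr hf, Subgroup.card_top]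
  rw [← Nat.card_congr e]
  conv_lhs => rw [hrange]
  rw [Subgroup.card_mul_index, Nat.card_fun, Nat.card_fin]

theorem card_centralPower {H : Type*} [Group H] [Finite H] {p k : ℕ} (hp : p.Prime) (hk : 1 ≤ k)
    (hH : Nat.card H = p ^ 3) (hZ : Nat.card (Subgroup.center H) = p) :
    Nat.card (CentralPower H k) = p ^ (2 * k + 1) := by
  have h1 := card_centralKernel_mul_card_center H hk
  have h2 := Subgroup.card_eq_card_quotient_mul_card_subgroup (centralKernel H k)
  rw [Nat.card_fun, Nat.card_fin, hH] at h2
  rw [hZ] at h1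
  refine Nat.eq_of_mul_eq_mul_right (pow_pos hp.pos k) ?_
  calc Nat.card (CentralPower H k) * p ^ k
      = Nat.card (CentralPower H k) * Nat.card (centralKernel H k) * p := by rw [← h1, mul_assoc]
    _ = p ^ (2 * k + 1) * p ^ k := by rw [← h2]; ring

theorem not_commutative_of_centralPower {G H : Type*} [Group G] [Group H] {k : ℕ}
    (e : G ≃* CentralPower H k) (hG : ¬ ∀ a b : G, a * b = b * a) :
    ¬ ∀ a b : H, a * b = b * a := by
  intro hH
  refine hG fun a b => e.injective ?_
  rw [map_mul, map_mul]
  obtain ⟨u, hu⟩ := QuotientGroup.mk_surjective (e a)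
  obtain ⟨v, hv⟩ := QuotientGroup.mk_surjective (e b)
  rw [← hu, ← hv, ← QuotientGroup.mk_mul, ← QuotientGroup.mk_mul]
  congr 1
  funext i
  exact hH _ _

theorem pow_eq_one_of_centralPower {H : Type*} [Group H] {k n : ℕ} (h : ∀ a : H, a ^ n = 1)
    (g : CentralPower H k) : g ^ n = 1 := by
  obtain ⟨u, rfl⟩ := QuotientGroup.mk_surjective g
  rw [← QuotientGroup.mk_pow, show u ^ n = 1 from funext fun i => h _, QuotientGroup.mk_one]

-- A factor embeds in the central power: a tuple supported at one coordinate lies in `centralKernel`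
-- only if its entry, the product of the tuple, is `1`.
open scoped IsMulCommutative in
theorem pow_eq_one_of_forall_centralPower {H : Type*} [Group H] {k n : ℕ} (hk : 1 ≤ k)
    (h : ∀ g : CentralPower H k, g ^ n = 1) (a : H) : a ^ n = 1 := by
  have h1 := h (QuotientGroup.mk (Pi.mulSingle ⟨0, hk⟩ a))
  rw [← QuotientGroup.mk_pow, QuotientGroup.eq_one_iff] at h1
  obtain ⟨z, hz, hz1⟩ := h1
  rw [← Pi.mulSingle_pow] at hz
  have h0 := hz ⟨0, hk⟩
  rw [Pi.mulSingle_eq_same] at h0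
  rw [Finset.prod_eq_single ⟨0, hk⟩ (fun i _ hi => ?_) (by simp)] at hz1
  · rw [h0, hz1, Subgroup.coe_one]
  · have := hz i
    rw [Pi.mulSingle_eq_of_ne hi] at this
    exact Subtype.ext this.symm

theorem mul_eq_mul_swap_of_commutator {G : Type*} [Group G] {x y z : G}
    (h : ⁅x, y⁆ * z⁻¹ = 1) : x * y = z * (y * x) := by
  rw [← mul_inv_eq_one.mp h, commutatorElement_def]
  group

theorem mul_eq_mul_swap_of_conj {G : Type*} [Group G] {x y : G} {n : ℕ}
    (h : y⁻¹ * x * y = x ^ (n + 1)) (hcomm : y * x ^ n = x ^ n * y) :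
    x * y = x ^ n * (y * x) := by
  rw [mul_assoc, inv_mul_eq_iff_eq_mul, pow_succ, ← mul_assoc, hcomm, mul_assoc] at h
  exact h

section Presented

variable {p : ℕ}

theorem HeisenbergGroup.exists_generators (p : ℕ) : ∃ x y z : HeisenbergGroup p,
    z ∈ Subgroup.center (HeisenbergGroup p) ∧ x * y = z * (y * x) ∧
      Subgroup.closure {x, y, z} = ⊤ ∧ x ^ p = 1 ∧ y ^ p = 1 ∧ z ^ p = 1 := by
  let of : Fin 3 → HeisenbergGroup p := PresentedGroup.of
  have hgen : Subgroup.closure {of 0, of 1, of 2} = ⊤ := by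
    rw [← PresentedGroup.closure_range_of]
    congr 1
    ext g
    simp [Fin.exists_fin_succ, of, eq_comm]
  have hx : of 0 ^ p = 1 := PresentedGroup.one_of_mem (x := FreeGroup.of 0 ^ p) (by simp)
  have hy : of 1 ^ p = 1 := PresentedGroup.one_of_mem (x := FreeGroup.of 1 ^ p) (by simp)
  have hz : of 2 ^ p = 1 := PresentedGroup.one_of_mem (x := FreeGroup.of 2 ^ p) (by simp)
  have hxz : of 0 * of 2 = of 2 * of 0 := by
    rw [← commutatorElement_eq_one_iff_mul_comm]
    exact PresentedGroup.one_of_mem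
      (x := ⁅FreeGroup.of (0 : Fin 3), FreeGroup.of (2 : Fin 3)⁆) (by simp)
  have hyz : of 1 * of 2 = of 2 * of 1 := by
    rw [← commutatorElement_eq_one_iff_mul_comm]
    exact PresentedGroup.one_of_mem
      (x := ⁅FreeGroup.of (1 : Fin 3), FreeGroup.of (2 : Fin 3)⁆) (by simp)
  have hxy : ⁅of 0, of 1⁆ * (of 2)⁻¹ = 1 := PresentedGroup.one_of_mem
      (x := ⁅FreeGroup.of (0 : Fin 3), FreeGroup.of (1 : Fin 3)⁆ * (FreeGroup.of 2)⁻¹) (by simp)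
  refine ⟨of 0, of 1, of 2, mem_center_of_closure_eq_top hgen ?_, ?_, hgen, hx, hy, hz⟩
  · rintro g (rfl | rfl | rfl)
    exacts [hxz, hyz, rfl]
  · exact mul_eq_mul_swap_of_commutator hxy

/-- Here `x ^ p` plays the role of the central generator `z`, so both presentations fall under the
same lemmas. -/
theorem ModularGroupCube.exists_generators (p : ℕ) : ∃ x y : ModularGroupCube p,
    x ^ p ∈ Subgroup.center (ModularGroupCube p) ∧ x * y = x ^ p * (y * x) ∧
      Subgroup.closure {x, y, x ^ p} = ⊤ ∧ (x ^ p) ^ p = 1 ∧ y ^ p = 1 := by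
  let of : Fin 2 → ModularGroupCube p := PresentedGroup.of
  have hgen : Subgroup.closure {of 0, of 1} = ⊤ := by
    rw [← PresentedGroup.closure_range_of]
    congr 1
    ext g
    simp [of, eq_comm]
  have hx : of 0 ^ (p ^ 2) = 1 :=
    PresentedGroup.one_of_mem (x := FreeGroup.of 0 ^ (p ^ 2)) (by simp)
  have hy : of 1 ^ p = 1 := PresentedGroup.one_of_mem (x := FreeGroup.of 1 ^ p) (by simp)
  have hxy : (of 1)⁻¹ * of 0 * of 1 * (of 0 ^ (p + 1))⁻¹ = 1 := PresentedGroup.one_of_mem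
    (x := (FreeGroup.of 1)⁻¹ * FreeGroup.of 0 * FreeGroup.of 1 * (FreeGroup.of 0 ^ (p + 1))⁻¹)
    (by simp)
  have hconj : (of 1)⁻¹ * of 0 * of 1 = of 0 ^ (p + 1) := mul_inv_eq_one.mp hxy
  have hcomm : of 1 * of 0 ^ p = of 0 ^ p * of 1 := by
    have h1 : (of 1)⁻¹ * of 0 ^ p * of 1 = of 0 ^ p := by
      -- `y⁻¹ * x ^ p * y = (x ^ (p + 1)) ^ p = x ^ (p ^ 2) * x ^ p = x ^ p`.
      have := conj_pow (a := (of 1)⁻¹) (b := of 0) (i := p)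
      rw [inv_inv, hconj, ← pow_mul, add_mul, one_mul, ← sq, pow_add, hx, one_mul] at this
      exact this.symm
    rw [mul_assoc, inv_mul_eq_iff_eq_mul] at h1
    exact h1.symm
  refine ⟨of 0, of 1, mem_center_of_closure_eq_top hgen ?_, ?_, ?_, ?_, hy⟩
  · rintro g (rfl | rfl)
    exacts [(pow_succ' _ _).symm.trans (pow_succ _ _), hcomm]
  · exact mul_eq_mul_swap_of_conj hconj hcomm
  · rw [eq_top_iff, ← hgen]
    exact Subgroup.closure_mono (by intro g; simp; tauto)
  · rw [← pow_mul, ← sq, hx]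

variable {G : Type*} [Group G] {k : ℕ}

theorem card_and_pow_of_equiv_centralPower_heisenberg (hp : p.Prime) (hodd : Odd p) (hk : 1 ≤ k)
    (hG : ¬ ∀ a b : G, a * b = b * a) (e : G ≃* CentralPower (HeisenbergGroup p) k) :
    Nat.card G = p ^ (2 * k + 1) ∧ ∀ g : G, g ^ p = 1 := by
  obtain ⟨x, y, z, hz, hxy, hgen, hxp, hyp, hzp⟩ := HeisenbergGroup.exists_generators p
  obtain ⟨hfin, h3, hZ⟩ := card_and_card_center_of_generators hp hodd hz hxy hgen hzp hyp
    (hxp ▸ one_mem _) (not_commutative_of_centralPower e hG)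
  refine ⟨by rw [Nat.card_congr e.toEquiv, card_centralPower hp hk h3 hZ], fun g => ?_⟩
  apply e.injective
  rw [map_pow, map_one]
  exact pow_eq_one_of_centralPower (pow_eq_one_of_generators
    (mul_pow_of_generators hodd hz hxy hgen hzp) hgen hxp hyp hzp) _

theorem card_and_pow_of_equiv_centralPower_modular (hp : p.Prime) (hodd : Odd p) (hk : 1 ≤ k)
    (hG : ¬ ∀ a b : G, a * b = b * a) (e : G ≃* CentralPower (ModularGroupCube p) k) :
    Nat.card G = p ^ (2 * k + 1) ∧ ∃ g : G, g ^ p ≠ 1 := by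
  obtain ⟨x, y, hz, hxy, hgen, hzp, hyp⟩ := ModularGroupCube.exists_generators p
  have hH := not_commutative_of_centralPower e hG
  obtain ⟨hfin, h3, hZ⟩ := card_and_card_center_of_generators hp hodd hz hxy hgen hzp hyp
    (Subgroup.mem_zpowers _) hH
  refine ⟨by rw [Nat.card_congr e.toEquiv, card_centralPower hp hk h3 hZ], ?_⟩
  -- Exponent `p` would give `x ^ p = 1` in the factor, whose commutators are all powers of `x ^ p`.
  by_contra! hall
  have hx : x ^ p = 1 := pow_eq_one_of_forall_centralPower hk (fun g => by
    rw [← e.apply_symm_apply g, ← map_pow, hall, map_one]) x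
  refine hH fun a b => ?_
  obtain ⟨n, hn⟩ := commutator_mem_zpowers hz hxy hgen a b
  have hn : (x ^ p) ^ n = ⁅a, b⁆ := hn
  rw [hx, one_zpow] at hn
  exact commutatorElement_eq_one_iff_mul_comm.mp hn.symm

end Presented

/-! ### Counting the subsets with a given image -/

theorem ncard_nonemptySubsets (α : Type*) [Finite α] :
    (nonemptySubsets α).ncard = 2 ^ Nat.card α - 1 := by
  have h : nonemptySubsets α = {∅}ᶜ := by
    ext S
    simp [nonemptySubsets, Set.nonempty_iff_ne_empty]
  have hc : Nat.card (Set α) = 2 ^ Nat.card α := by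
    classical
    have := Fintype.ofFinite α
    rw [Nat.card_eq_fintype_card, Nat.card_eq_fintype_card, Fintype.card_set]
  rw [h, Set.ncard_compl, Set.ncard_singleton, hc]

/-- `S` is recovered from its traces on the fibres over `L`, which are arbitrary non-empty subsets.
-/
theorem ncard_setOf_image_eq {α β : Type*} [Finite α] (f : α → β) (L : Finset β) :
    {S : Set α | f '' S = L}.ncard = ∏ l ∈ L, (2 ^ Nat.card {x // f x = l} - 1) := by
  let e : {S : Set α | f '' S = L} ≃ ((l : L) → nonemptySubsets {x // f x = l}) :=
    { toFun := fun S l => ⟨{x | x.1 ∈ S.1}, by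
        obtain ⟨x, hx, hxl⟩ : l.1 ∈ f '' S.1 := by rw [S.2]; exact l.2
        exact ⟨⟨x, hxl⟩, hx⟩⟩
      invFun := fun T => ⟨{x | ∃ h : f x ∈ L, ⟨x, rfl⟩ ∈ (T ⟨f x, h⟩).1}, by
        ext l
        constructor
        · rintro ⟨x, ⟨h, -⟩, rfl⟩
          exact h
        · intro hl
          obtain ⟨⟨x, hxl⟩, hx⟩ := (T ⟨l, hl⟩).2
          change f x = l at hxl
          subst hxl
          exact ⟨x, ⟨hl, hx⟩, rfl⟩⟩
      left_inv := fun S => by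
        apply Subtype.ext
        ext x
        refine ⟨fun ⟨_, hx⟩ => hx, fun hx => ⟨?_, hx⟩⟩
        have : f x ∈ f '' S.1 := ⟨x, hx, rfl⟩
        rwa [S.2] at this
      right_inv := fun T => by
        funext ⟨l, hl⟩
        apply Subtype.ext
        ext ⟨x, hxl⟩
        change f x = l at hxl
        subst hxl
        exact ⟨fun ⟨_, hx⟩ => hx, fun hx => ⟨hl, hx⟩⟩ }
  rw [← Nat.card_coe_set_eq, Nat.card_congr e, Nat.card_pi,
    ← Finset.prod_coe_sort L (fun l => 2 ^ Nat.card {x // f x = l} - 1)]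
  refine Finset.prod_congr rfl fun l _ => ?_
  rw [Nat.card_coe_set_eq, ncard_nonemptySubsets]

/-! ### Values of `|N_{n,L}|` in a finite group -/

section PowerSolutions

variable {G : Type*} [Group G] [Finite G] {n : ℕ}

theorem ncard_powerSolutions (n : ℕ) {L : Finset G} (hL : (L : Set G) ∈ nonemptySubsets G) :
    (powerSolutions n (L : Set G)).ncard = ∏ l ∈ L, (2 ^ Nat.card {x : G // x ^ n = l} - 1) := by
  rw [← ncard_setOf_image_eq]
  congr 1
  ext S
  refine ⟨fun h => h.2, fun h => ⟨?_, h⟩⟩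
  have : ((fun s => s ^ n) '' S).Nonempty := by rw [show _ '' S = _ from h]; exact hL
  exact this.of_image

theorem ncard_powerSolutions_of_coprime (hn : (Nat.card G).Coprime n) {L : Set G}
    (hL : L ∈ nonemptySubsets G) : (powerSolutions n L).ncard = 1 := by
  lift L to Finset G using L.toFinite
  rw [ncard_powerSolutions n hL]
  refine Finset.prod_eq_one fun l _ => ?_
  have : Nat.card {x : G // x ^ n = l} = 1 := by
    rw [Nat.card_eq_one_iff_unique]
    obtain ⟨hinj, hsurj⟩ := hn.pow_left_bijective
    obtain ⟨x, hx⟩ := hsurj l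
    exact ⟨⟨fun a b => Subtype.ext (hinj (a.2.trans b.2.symm))⟩, ⟨x, hx⟩⟩
  norm_num [this]

theorem ncard_powerSolutions_eq_zero {L : Set G} {l : G} (hl : l ∈ L)
    (hn : ∀ x : G, x ^ n ≠ l) : (powerSolutions n L).ncard = 0 := by
  rw [Set.ncard_eq_zero]
  refine Set.eq_empty_of_forall_notMem fun S hS => ?_
  obtain ⟨x, -, hx⟩ : l ∈ (fun s => s ^ n) '' S := hS.2 ▸ hl
  exact hn x hx

theorem ncard_powerSolutions_of_hom (f : G →* G) (hf : ∀ g, f g = g ^ n) {L : Set G}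
    (hL : L ∈ nonemptySubsets G) (hLf : L ⊆ f.range) :
    (powerSolutions n L).ncard = (2 ^ Nat.card f.ker - 1) ^ L.ncard := by
  lift L to Finset G using L.toFinite
  rw [ncard_powerSolutions n hL, Set.ncard_coe_finset]
  refine Finset.prod_eq_pow_card fun l hl => ?_
  obtain ⟨a, rfl⟩ := hLf hl
  congr 2
  refine Nat.card_congr ((Equiv.mulLeft a⁻¹).subtypeEquiv fun x => ?_)
  rw [← hf, Equiv.coe_mulLeft, MonoidHom.mem_ker, map_mul, map_inv, inv_mul_eq_one, eq_comm]

theorem ncard_powerSolutions_one_of_trivial (hn : ∀ g : G, g ^ n = 1) :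
    (powerSolutions n ({1} : Set G)).ncard = 2 ^ Nat.card G - 1 := by
  have := ncard_powerSolutions n (L := {(1 : G)}) (by simp [nonemptySubsets])
  rw [Finset.coe_singleton, Finset.prod_singleton] at this
  rw [this, Nat.card_congr (Equiv.subtypeUnivEquiv hn)]

theorem one_mem_solutionCounts : 1 ∈ solutionCounts G :=
  ⟨1, one_pos, {1}, Set.singleton_nonempty 1,
    ncard_powerSolutions_of_coprime (Nat.coprime_one_right _) (Set.singleton_nonempty 1)⟩

theorem zero_mem_solutionCounts [Nontrivial G] : 0 ∈ solutionCounts G := by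
  obtain ⟨g, hg⟩ := exists_ne (1 : G)
  exact ⟨Nat.card G, Nat.card_pos, {g}, Set.singleton_nonempty g,
    ncard_powerSolutions_eq_zero rfl fun x => by
      rw [pow_card_eq_one']; exact hg.symm⟩

theorem card_nonemptySubsets_mem_solutionCounts : 2 ^ Nat.card G - 1 ∈ solutionCounts G :=
  ⟨Nat.card G, Nat.card_pos, {1}, Set.singleton_nonempty 1,
    ncard_powerSolutions_one_of_trivial fun _ => pow_card_eq_one'⟩

end PowerSolutions

/-! ### Extraspecial groups -/

namespace IsExtraspecial

variable {p : ℕ} {G : Type*} [Group G]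

theorem card_center (hG : IsExtraspecial p G) : Nat.card (Subgroup.center G) = p := by
  rw [← hG.commutator_eq_center, hG.card_commutator]

theorem not_commutative (hp : p.Prime) (hG : IsExtraspecial p G) :
    ¬ ∀ a b : G, a * b = b * a := by
  intro h
  have h1 : Subgroup.center G = ⊤ :=
    eq_top_iff.mpr fun a _ => Subgroup.mem_center_iff.mpr fun b => h b a
  have h2 := hG.card_commutator
  rw [(commutator_eq_bot_iff_center_eq_top G).mpr h1, Subgroup.card_bot] at h2
  exact hp.one_lt.ne h2

theorem commutator_mem_center (hG : IsExtraspecial p G) (x y : G) :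
    ⁅x, y⁆ ∈ Subgroup.center G := by
  rw [← hG.commutator_eq_center]
  exact Subgroup.commutator_mem_commutator (Subgroup.mem_top x) (Subgroup.mem_top y)

theorem pow_eq_one_of_mem_center (hG : IsExtraspecial p G) {z : G}
    (hz : z ∈ Subgroup.center G) : z ^ p = 1 := by
  have := pow_card_eq_one' (x := (⟨z, hz⟩ : Subgroup.center G))
  rw [hG.card_center] at this
  exact congrArg Subtype.val this

/-- A conjugate of `x` is `x` times a central commutator of exponent `p`, so `x ^ p` is fixed by
conjugation. -/
theorem pow_mem_center (hG : IsExtraspecial p G) (x : G) : x ^ p ∈ Subgroup.center G := by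
  rw [Subgroup.mem_center_iff]
  intro y
  have hc := hG.commutator_mem_center y x
  have h : (y * x * y⁻¹) ^ p = x ^ p := by
    rw [show y * x * y⁻¹ = ⁅y, x⁆ * x by simp [commutatorElement_def],
      Commute.mul_pow (Subgroup.mem_center_iff.mp hc x).symm,
      hG.pow_eq_one_of_mem_center hc, one_mul]
  rw [conj_pow, mul_inv_eq_iff_eq_mul] at h
  exact h

theorem pow_sq_eq_one (hG : IsExtraspecial p G) (x : G) : x ^ (p * p) = 1 := by
  rw [pow_mul, hG.pow_eq_one_of_mem_center (hG.pow_mem_center x)]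

theorem card_coprime (hp : p.Prime) (hG : IsExtraspecial p G) {n : ℕ} (hn : ¬ p ∣ n) :
    (Nat.card G).Coprime n := by
  have := hG.finite
  have := Fact.mk hp
  obtain ⟨m, hm⟩ := IsPGroup.iff_card.mp hG.isPGroup
  rw [hm]
  exact Nat.Coprime.pow_left m ((hp.coprime_iff_not_dvd).mpr hn)

theorem nontrivial (hp : p.Prime) (hG : IsExtraspecial p G) : Nontrivial G := by
  by_contra h
  rw [not_nontrivial_iff_subsingleton] at h
  exact hG.not_commutative hp fun a b => Subsingleton.elim _ _

/-- For odd `p`, taking powers with an exponent divisible by `p` is an endomorphism. -/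
theorem exists_powHom (hG : IsExtraspecial p G) (hodd : Odd p) {n : ℕ} (hn : p ∣ n) :
    ∃ f : G →* G, ∀ g, f g = g ^ n := by
  obtain ⟨m, rfl⟩ := hn
  refine ⟨MonoidHom.mk' (fun g => g ^ (p * m)) fun a b => ?_, fun _ => rfl⟩
  rw [pow_mul, mul_pow_odd_of_commutator hodd hG.commutator_mem_center
    (fun x y => hG.pow_eq_one_of_mem_center (hG.commutator_mem_center x y)), pow_mul, pow_mul]
  exact Commute.mul_pow (Subgroup.mem_center_iff.mp (hG.pow_mem_center b) _) m

theorem range_le_center (hG : IsExtraspecial p G) {n : ℕ} (hn : p ∣ n) {f : G →* G}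
    (hf : ∀ g, f g = g ^ n) : f.range ≤ Subgroup.center G := by
  rintro _ ⟨g, rfl⟩
  obtain ⟨m, rfl⟩ := hn
  rw [hf, pow_mul]
  exact pow_mem (hG.pow_mem_center g) m

theorem inClassD_of_odd (hp : p.Prime) (hodd : Odd p) (hG : IsExtraspecial p G) : InClassD G := by
  have := hG.finite
  refine ⟨hG.finite, fun n hn L hL h0 => ?_⟩
  by_cases hpn : p ∣ n
  · obtain ⟨f, hf⟩ := hG.exists_powHom hodd hpn
    have hLf : L ⊆ f.range := by
      intro l hl
      by_contra h
      exact h0 (ncard_powerSolutions_eq_zero hl fun x hx => h ⟨x, (hf x).trans hx⟩)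
    rw [ncard_powerSolutions_of_hom f hf hL hLf, ncard_nonemptySubsets]
    exact pow_dvd_pow_of_dvd (Nat.pow_sub_one_dvd_pow_sub_one 2 f.ker.card_subgroup_dvd_card) _
  · rw [ncard_powerSolutions_of_coprime (hG.card_coprime hp hpn) hL]
    exact one_dvd _

theorem solutionCounts_of_pow_eq_one (hp : p.Prime) (hG : IsExtraspecial p G)
    (h1 : ∀ g : G, g ^ p = 1) : solutionCounts G = {0, 1, 2 ^ Nat.card G - 1} := by
  have := hG.finite
  have := hG.nontrivial hp
  apply Set.Subset.antisymm
  · rintro _ ⟨n, hn, L, hL, rfl⟩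
    by_cases hpn : p ∣ n
    · obtain ⟨m, rfl⟩ := hpn
      have ht : ∀ g : G, g ^ (p * m) = 1 := fun g => by rw [pow_mul, h1, one_pow]
      by_cases hL1 : ∃ l ∈ L, l ≠ 1
      · obtain ⟨l, hl, hl1⟩ := hL1
        left
        exact ncard_powerSolutions_eq_zero hl fun x => by rw [ht]; exact hl1.symm
      · push Not at hL1
        obtain rfl : L = {1} := Set.eq_singleton_iff_nonempty_unique_mem.mpr ⟨hL, hL1⟩
        right; right
        exact ncard_powerSolutions_one_of_trivial ht
    · right; left
      exact ncard_powerSolutions_of_coprime (hG.card_coprime hp hpn) hL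
  · rintro _ (rfl | rfl | rfl)
    exacts [zero_mem_solutionCounts, one_mem_solutionCounts,
      card_nonemptySubsets_mem_solutionCounts]

theorem solutionCounts_of_pow_ne_one (hp : p.Prime) (hodd : Odd p) (hG : IsExtraspecial p G)
    (h1 : ∃ g : G, g ^ p ≠ 1) {m : ℕ} (hm : Nat.card G = p ^ (m + 1)) :
    solutionCounts G = {0, 1, 2 ^ Nat.card G - 1} ∪
      {c | ∃ j : ℕ, 1 ≤ j ∧ j ≤ p ∧ c = (2 ^ p ^ m - 1) ^ j} := by
  have := hG.finite
  have := hG.nontrivial hp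
  -- The center has prime order, so the image is trivial or everything.
  have hker : ∀ {n : ℕ}, p ∣ n → ∀ {f : G →* G}, (∀ g, f g = g ^ n) →
      f.range = ⊥ ∨ f.range = Subgroup.center G ∧ Nat.card f.ker = p ^ m := by
    intro n hn f hf
    have hle := hG.range_le_center hn hf
    have hdvd := Subgroup.card_dvd_of_le hle
    rw [hG.card_center, Nat.dvd_prime hp] at hdvd
    refine hdvd.imp (fun h => Subgroup.card_eq_one.mp h) fun h => ?_
    refine ⟨Subgroup.eq_of_le_of_card_ge hle (by rw [hG.card_center, h]), ?_⟩
    have := Subgroup.card_mul_index f.ker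
    rw [Subgroup.index_ker, h, hm, pow_succ] at this
    exact Nat.eq_of_mul_eq_mul_right hp.pos this
  apply Set.Subset.antisymm
  · rintro _ ⟨n, hn, L, hL, rfl⟩
    by_cases hpn : p ∣ n
    · obtain ⟨f, hf⟩ := hG.exists_powHom hodd hpn
      by_cases hLf : L ⊆ f.range
      · rw [ncard_powerSolutions_of_hom f hf hL hLf]
        have hpos : 0 < L.ncard := (Set.ncard_pos).mpr hL
        rcases hker hpn hf with h | ⟨h, hc⟩
        · left; right; right
          rw [h] at hLf
          obtain rfl : L = {1} :=
            Set.eq_singleton_iff_nonempty_unique_mem.mpr ⟨hL, fun l hl => hLf hl⟩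
          have : f.ker = ⊤ := by
            rw [eq_top_iff]
            intro g _
            have : f g ∈ f.range := ⟨g, rfl⟩
            rw [h] at this
            exact this
          rw [this, Subgroup.card_top, Set.ncard_singleton, pow_one]; rfl
        · right
          refine ⟨L.ncard, hpos, ?_, by rw [hc]⟩
          rw [h] at hLf
          have := Set.ncard_le_ncard hLf
          rwa [← Nat.card_coe_set_eq (Subgroup.center G : Set G), SetLike.coe_sort_coe,
            hG.card_center] at this
      · obtain ⟨l, hl, hlf⟩ := Set.not_subset.mp hLf
        left; left
        exact ncard_powerSolutions_eq_zero hl fun x hx => hlf ⟨x, (hf x).trans hx⟩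
    · left; right; left
      exact ncard_powerSolutions_of_coprime (hG.card_coprime hp hpn) hL
  · rintro _ ((rfl | rfl | rfl) | ⟨j, hj1, hjp, rfl⟩)
    · exact zero_mem_solutionCounts
    · exact one_mem_solutionCounts
    · exact card_nonemptySubsets_mem_solutionCounts
    · obtain ⟨f, hf⟩ := hG.exists_powHom hodd dvd_rfl
      rcases hker dvd_rfl hf with h | ⟨h, hc⟩
      · obtain ⟨g, hg⟩ := h1
        have : f g ∈ f.range := ⟨g, rfl⟩
        rw [h, Subgroup.mem_bot, hf] at this
        exact (hg this).elim
      · obtain ⟨L, hLs, hLc⟩ := Set.exists_subset_card_eq (s := (f.range : Set G)) (n := j) (by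
          rwa [h, ← Nat.card_coe_set_eq (Subgroup.center G : Set G), SetLike.coe_sort_coe,
            hG.card_center])
        have hL : L.Nonempty := (Set.ncard_pos).mp (by omega)
        exact ⟨p, hp.pos, L, hL, by rw [ncard_powerSolutions_of_hom f hf hL hLs, hc, hLc]⟩

end IsExtraspecial

/-! ### Extraspecial `2`-groups -/

namespace IsExtraspecial

variable {G : Type*} [Group G]

theorem exists_center_eq_pair (hG : IsExtraspecial 2 G) :
    ∃ z : G, z ≠ 1 ∧ z ∈ Subgroup.center G ∧ ∀ u ∈ Subgroup.center G, u = 1 ∨ u = z := by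
  obtain ⟨a, b, hab, huniv⟩ := Nat.card_eq_two_iff.mp hG.card_center
  have hall : ∀ u : Subgroup.center G, u = a ∨ u = b := fun u => by
    have : u ∈ ({a, b} : Set _) := huniv ▸ Set.mem_univ u
    exact this
  rcases hall 1 with rfl | rfl
  · exact ⟨b, fun h => hab (Subtype.ext h.symm), b.2, fun u hu =>
      (hall ⟨u, hu⟩).imp (congrArg Subtype.val) (congrArg Subtype.val)⟩
  · exact ⟨a, fun h => hab (Subtype.ext h), a.2, fun u hu =>
      (hall ⟨u, hu⟩).symm.imp (congrArg Subtype.val) (congrArg Subtype.val)⟩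

open Classical in
/-- The nontrivial character of the center of an extraspecial `2`-group, extended to the whole
group by the value `-1`. -/
noncomputable def centralSign (u : G) : ℤ := if u = 1 then 1 else -1

theorem centralSign_one : centralSign (1 : G) = 1 := if_pos rfl

theorem centralSign_of_ne {u : G} (h : u ≠ 1) : centralSign u = -1 := if_neg h

theorem centralSign_mul_self (u : G) : centralSign u * centralSign u = 1 := by
  unfold centralSign
  split_ifs <;> rfl

theorem centralSign_mul (hG : IsExtraspecial 2 G) {u v : G} (hu : u ∈ Subgroup.center G)
    (hv : v ∈ Subgroup.center G) : centralSign (u * v) = centralSign u * centralSign v := by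
  obtain ⟨z, hz1, hz, hall⟩ := hG.exists_center_eq_pair
  have hzz : z * z = 1 := by rw [← sq, hG.pow_eq_one_of_mem_center hz]
  rcases hall u hu with rfl | rfl <;> rcases hall v hv with rfl | rfl <;>
    simp [centralSign, *]

/-- Character orthogonality: translating `y` by some `w` that does not commute with `g` negates
every term. -/
theorem sum_centralSign_commutator [Fintype G] (hG : IsExtraspecial 2 G) {g : G}
    (hg : g ∉ Subgroup.center G) : ∑ y : G, centralSign ⁅y, g⁆ = 0 := by
  obtain ⟨w, hw⟩ : ∃ w, ⁅w, g⁆ ≠ 1 := by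
    by_contra! h
    exact hg (Subgroup.mem_center_iff.mpr fun w => commutatorElement_eq_one_iff_mul_comm.mp (h w))
  have hmul : ∀ y : G, centralSign ⁅w * y, g⁆ = -centralSign ⁅y, g⁆ := fun y => by
    have h1 : ⁅w * y, g⁆ = ⁅y, g⁆ * ⁅w, g⁆ := by
      have : ⁅w * y, g⁆ = w * ⁅y, g⁆ * w⁻¹ * ⁅w, g⁆ := by
        simp only [commutatorElement_def]; group
      rw [this, Subgroup.mem_center_iff.mp (hG.commutator_mem_center y g) w,
        mul_inv_cancel_right]
    rw [h1, hG.centralSign_mul (hG.commutator_mem_center _ _) (hG.commutator_mem_center _ _),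
      centralSign_of_ne hw, mul_neg_one]
  have h2 := Equiv.sum_comp (Equiv.mulLeft w) fun y : G => centralSign ⁅y, g⁆
  simp only [Equiv.coe_mulLeft, hmul, Finset.sum_neg_distrib] at h2
  linarith

/-- Expand the square over pairs `(g * y, y)`. Since `(g * y) ^ 2 = ⁅y, g⁆ * (g ^ 2 * y ^ 2)`, the
factors in `y ^ 2` cancel; summing over `y` kills each non-central `g`, and each of the two central
ones contributes `|G|`. -/
theorem sq_sum_centralSign_sq [Fintype G] (hG : IsExtraspecial 2 G) :
    (∑ x : G, centralSign (x ^ 2)) ^ 2 = 2 * Nat.card G := by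
  classical
  have hterm : ∀ g y : G, centralSign ((g * y) ^ 2) * centralSign (y ^ 2) =
      centralSign (g ^ 2) * centralSign ⁅y, g⁆ := fun g y => by
    have hc := hG.commutator_mem_center y g
    rw [mul_pow_of_central_swap hc (by simp [commutatorElement_def, mul_assoc]),
      Nat.choose_self, pow_one,
      hG.centralSign_mul hc (mul_mem (hG.pow_mem_center g) (hG.pow_mem_center y)),
      hG.centralSign_mul (hG.pow_mem_center g) (hG.pow_mem_center y)]
    linear_combination
      centralSign ⁅y, g⁆ * centralSign (g ^ 2) * centralSign_mul_self (y ^ 2)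
  have hinner : ∀ g : G, ∑ y : G, centralSign (g ^ 2) * centralSign ⁅y, g⁆ =
      if g ∈ Subgroup.center G then (Nat.card G : ℤ) else 0 := fun g => by
    rw [← Finset.mul_sum]
    split_ifs with hg
    · have : ∀ y : G, ⁅y, g⁆ = 1 := fun y =>
        commutatorElement_eq_one_iff_mul_comm.mpr (Subgroup.mem_center_iff.mp hg y)
      simp [this, hG.pow_eq_one_of_mem_center hg, centralSign_one]
    · rw [hG.sum_centralSign_commutator hg, mul_zero]
  calc (∑ x : G, centralSign (x ^ 2)) ^ 2
      = ∑ y : G, ∑ x : G, centralSign (x ^ 2) * centralSign (y ^ 2) := by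
        rw [sq, Finset.sum_mul_sum, Finset.sum_comm]
    _ = ∑ y : G, ∑ g : G, centralSign ((g * y) ^ 2) * centralSign (y ^ 2) :=
        Finset.sum_congr rfl fun y _ => (Equiv.sum_comp (Equiv.mulRight y)
          fun x : G => centralSign (x ^ 2) * centralSign (y ^ 2)).symm
    _ = ∑ g : G, if g ∈ Subgroup.center G then (Nat.card G : ℤ) else 0 := by
        rw [Finset.sum_comm]
        exact Finset.sum_congr rfl fun g _ => by simp only [hterm, hinner]
    _ = 2 * Nat.card G := by
        have hcard := hG.card_center
        rw [Nat.card_eq_fintype_card, Fintype.card_subtype] at hcard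
        rw [← Finset.sum_filter, Finset.sum_const, hcard, nsmul_eq_mul, Nat.cast_ofNat]

theorem card_sq_eq_of_two (hG : IsExtraspecial 2 G) :
    ∃ k : ℕ, 1 ≤ k ∧ Nat.card G = 2 ^ (2 * k + 1) ∧
      ∃ z : G, z ≠ 1 ∧ (∀ x : G, x ^ 2 = 1 ∨ x ^ 2 = z) ∧
        ((Nat.card {x : G // x ^ 2 = 1} = 4 ^ k + 2 ^ k ∧
            Nat.card {x : G // x ^ 2 = z} = 4 ^ k - 2 ^ k) ∨
          (Nat.card {x : G // x ^ 2 = 1} = 4 ^ k - 2 ^ k ∧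
            Nat.card {x : G // x ^ 2 = z} = 4 ^ k + 2 ^ k)) := by
  classical
  have := hG.finite
  have := Fintype.ofFinite G
  obtain ⟨z, hz1, hz, hall⟩ := hG.exists_center_eq_pair
  have hsq : ∀ x : G, x ^ 2 = 1 ∨ x ^ 2 = z := fun x => hall _ (hG.pow_mem_center x)
  have hz' : ∀ x : G, x ^ 2 = z ↔ ¬ x ^ 2 = 1 := fun x =>
    ⟨fun h => by rw [h]; exact hz1, (hsq x).resolve_left⟩
  have hsum := hG.sq_sum_centralSign_sq
  set S := ∑ x : G, centralSign (x ^ 2) with hS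
  set A := Nat.card {x : G // x ^ 2 = 1} with hA
  set B := Nat.card {x : G // x ^ 2 = z} with hB
  rw [Nat.card_eq_fintype_card, Fintype.card_subtype] at hA hB
  simp only [hz'] at hB
  have hAB : A + B = Nat.card G := by
    rw [hA, hB, Finset.card_filter_add_card_filter_not, Finset.card_univ,
      Nat.card_eq_fintype_card]
  have hSAB : S = A - B := by
    rw [hS, hA, hB]
    simp only [centralSign]
    rw [Finset.sum_ite, Finset.sum_const, Finset.sum_const]
    simp [sub_eq_add_neg]
  obtain ⟨m, hm⟩ := (IsPGroup.iff_card (p := 2)).mp hG.isPGroup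
  have hS2 : S.natAbs * S.natAbs = 2 ^ (m + 1) := by
    zify
    rw [abs_mul_abs_self, ← sq, hsum, hm, pow_succ']
    push_cast
    rfl
  -- From `(A - B) ^ 2 = 2 ^ (m + 1)` the difference is `±2 ^ (k + 1)` with `m = 2 * k + 1`. Both
  -- signs are kept, giving the two alternatives.
  obtain ⟨j, -, hj⟩ := (Nat.dvd_prime_pow Nat.prime_two).mp (Dvd.intro _ hS2)
  rw [hj, ← pow_add] at hS2
  have hjm := Nat.pow_right_injective le_rfl hS2
  have hnc := hG.not_commutative Nat.prime_two
  obtain ⟨k, rfl⟩ : ∃ k, j = k + 1 := ⟨j - 1, by omega⟩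
  obtain rfl : m = 2 * k + 1 := by omega
  have hk : 1 ≤ k := by
    by_contra h
    obtain rfl : k = 0 := by omega
    have := isCyclic_of_prime_card (p := 2) (hm.trans (by norm_num))
    exact hnc (IsCyclic.isMulCommutative (α := G)).is_comm.comm
  refine ⟨k, hk, hm, z, hz1, hsq, ?_⟩
  have h4 : 2 ^ (2 * k + 1) = 2 * 4 ^ k := by rw [pow_succ', pow_mul]; norm_num
  have h2 : 2 ^ (k + 1) = 2 * 2 ^ k := pow_succ' 2 k
  have hle : 2 ^ k ≤ 4 ^ k := Nat.pow_le_pow_left (by norm_num) k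
  rw [hm, h4] at hAB
  rw [h2, hSAB] at hj
  generalize 4 ^ k = a at *
  generalize 2 ^ k = b at *
  omega

/-- Divisibility of `2 ^ a - 1` into `2 ^ b - 1` forces `a ∣ b`, but `4 ^ k + 2 ^ k` has the odd
factor `2 ^ k + 1 > 1`. -/
theorem not_dvd_of_two {k : ℕ} (hk : 1 ≤ k) :
    ¬ 2 ^ (4 ^ k + 2 ^ k) - 1 ∣ 2 ^ 2 ^ (2 * k + 1) - 1 := by
  intro h
  have h1 := Nat.gcd_eq_left h
  rw [Nat.pow_sub_one_gcd_pow_sub_one] at h1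
  have h2 : ∀ n : ℕ, 1 ≤ 2 ^ n := fun n => Nat.one_le_two_pow
  have h3 : 2 ^ (4 ^ k + 2 ^ k).gcd (2 ^ (2 * k + 1)) = 2 ^ (4 ^ k + 2 ^ k) := by
    have ha := h2 ((4 ^ k + 2 ^ k).gcd (2 ^ (2 * k + 1)))
    have hb := h2 (4 ^ k + 2 ^ k)
    omega
  have h4 := Nat.gcd_eq_left_iff_dvd.mp (Nat.pow_right_injective le_rfl h3)
  have h5 : 2 ^ k + 1 ∣ 2 ^ (2 * k + 1) := by
    refine Dvd.dvd.trans ⟨2 ^ k, ?_⟩ h4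
    rw [show 4 = 2 * 2 by norm_num, mul_pow]
    ring
  have h6 : Nat.Coprime (2 ^ k + 1) (2 ^ (2 * k + 1)) := by
    refine Nat.Coprime.pow_right _ ?_
    rw [Nat.coprime_two_right]
    exact (Nat.even_pow.mpr ⟨even_two, by omega⟩).add_one
  have h7 := Nat.Coprime.eq_one_of_dvd h6 h5
  have := h2 k
  omega

/-- Fourth powers are trivial, so only `n` modulo `4` matters. -/
theorem two_dvd_cases {n : ℕ} (hG : IsExtraspecial 2 G) (hn : 2 ∣ n) :
    (∀ x : G, x ^ n = 1) ∨ ∀ x : G, x ^ n = x ^ 2 := by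
  obtain ⟨m, rfl⟩ := hn
  rcases Nat.even_or_odd' m with ⟨r, rfl | rfl⟩
  · left
    intro x
    rw [← mul_assoc, pow_mul, hG.pow_sq_eq_one, one_pow]
  · right
    intro x
    rw [mul_add, pow_add, ← mul_assoc, pow_mul, hG.pow_sq_eq_one, one_pow, one_mul, mul_one]

theorem solutionCounts_and_not_inClassD_of_two (hG : IsExtraspecial 2 G) :
    (∃ k : ℕ, 1 ≤ k ∧ Nat.card G = 2 ^ (2 * k + 1) ∧
      solutionCounts G =
        {0, 1, 2 ^ (4 ^ k - 2 ^ k) - 1, 2 ^ (4 ^ k + 2 ^ k) - 1,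
          (2 ^ (4 ^ k - 2 ^ k) - 1) * (2 ^ (4 ^ k + 2 ^ k) - 1), 2 ^ 2 ^ (2 * k + 1) - 1}) ∧
    ¬ InClassD G := by
  classical
  have := hG.finite
  have := hG.nontrivial Nat.prime_two
  obtain ⟨k, hk, hcard, z, hz1, hsq, hAB⟩ := hG.card_sq_eq_of_two
  have hL : ∀ {n : ℕ}, (∀ x : G, x ^ n = x ^ 2) → ∀ L : Finset G, L.Nonempty →
      (powerSolutions n (L : Set G)).ncard =
        ∏ l ∈ L, (2 ^ Nat.card {x : G // x ^ 2 = l} - 1) := fun hn L hL => by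
    rw [ncard_powerSolutions _ (Finset.coe_nonempty.mpr hL)]
    simp only [hn]
  have hone : ∀ {n : ℕ}, (∀ x : G, x ^ n = x ^ 2) → ∀ l : G,
      (powerSolutions n ({l} : Set G)).ncard = 2 ^ Nat.card {x : G // x ^ 2 = l} - 1 :=
    fun hn l => by
      rw [← Finset.coe_singleton, hL hn _ (Finset.singleton_nonempty l), Finset.prod_singleton]
  have hpair : ∀ {n : ℕ}, (∀ x : G, x ^ n = x ^ 2) →
      (powerSolutions n ({1, z} : Set G)).ncard =
        (2 ^ Nat.card {x : G // x ^ 2 = 1} - 1) * (2 ^ Nat.card {x : G // x ^ 2 = z} - 1) :=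
    fun hn => by
      have := hL hn {1, z} (Finset.insert_nonempty _ _)
      rwa [Finset.prod_pair hz1.symm, Finset.coe_pair] at this
  have hvals : solutionCounts G = {0, 1, 2 ^ Nat.card {x : G // x ^ 2 = 1} - 1,
      2 ^ Nat.card {x : G // x ^ 2 = z} - 1,
      (2 ^ Nat.card {x : G // x ^ 2 = 1} - 1) * (2 ^ Nat.card {x : G // x ^ 2 = z} - 1),
      2 ^ Nat.card G - 1} := by
    apply Set.Subset.antisymm
    · rintro _ ⟨n, hn, L, hLne, rfl⟩
      by_cases hpn : 2 ∣ n
      · rcases hG.two_dvd_cases hpn with ht | ht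
        · by_cases hL1 : L = {1}
          · rw [hL1, ncard_powerSolutions_one_of_trivial ht]
            simp
          · obtain ⟨l, hl, hl1⟩ : ∃ l ∈ L, l ≠ 1 := by
              by_contra! h
              exact hL1 (Set.eq_singleton_iff_nonempty_unique_mem.mpr ⟨hLne, h⟩)
            rw [ncard_powerSolutions_eq_zero hl fun x => by rw [ht]; exact hl1.symm]
            simp
        · by_cases hLz : L ⊆ {1, z}
          · rcases Set.subset_pair_iff_eq.mp hLz with rfl | rfl | rfl | rfl
            · exact (Set.not_nonempty_empty hLne).elim
            · simp [hone ht]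
            · simp [hone ht]
            · simp [hpair ht]
          · obtain ⟨l, hl, hlz⟩ := Set.not_subset.mp hLz
            rw [ncard_powerSolutions_eq_zero hl fun x hx => hlz ?_]
            · simp
            · rw [← hx, ht]
              exact hsq x
      · rw [ncard_powerSolutions_of_coprime (hG.card_coprime Nat.prime_two hpn) hLne]
        simp
    · have h2 : ∀ x : G, x ^ 2 = x ^ 2 := fun _ => rfl
      rintro _ (rfl | rfl | rfl | rfl | rfl | rfl)
      · exact zero_mem_solutionCounts
      · exact one_mem_solutionCounts
      · exact ⟨2, two_pos, {1}, Set.singleton_nonempty _, hone h2 1⟩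
      · exact ⟨2, two_pos, {z}, Set.singleton_nonempty _, hone h2 z⟩
      · exact ⟨2, two_pos, {1, z}, Set.insert_nonempty _ _, hpair h2⟩
      · exact card_nonemptySubsets_mem_solutionCounts
  have hnot : ∀ l : G, Nat.card {x : G // x ^ 2 = l} = 4 ^ k + 2 ^ k → ¬ InClassD G := by
    intro l hl hD
    have h := hD.2 2 two_pos {l} (Set.singleton_nonempty l)
    rw [hone (fun _ => rfl), hl, ncard_nonemptySubsets, Set.ncard_singleton, pow_one,
      hcard] at h
    refine not_dvd_of_two hk (h ?_)
    have : 2 ^ 1 ≤ 2 ^ (4 ^ k + 2 ^ k) :=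
      Nat.pow_le_pow_right two_pos (Nat.one_le_two_pow.trans (Nat.le_add_left _ _))
    omega
  refine ⟨⟨k, hk, hcard, ?_⟩, ?_⟩
  · rw [hvals, hcard]
    -- The set of values is symmetric in the two fibre sizes, so the sign of `A - B` leaves no
    -- trace.
    rcases hAB with ⟨hA, hB⟩ | ⟨hA, hB⟩
    · rw [hA, hB, mul_comm]
      congr 2
      exact Set.insert_comm _ _ _
    · rw [hA, hB]
  · rcases hAB with ⟨hA, hB⟩ | ⟨hA, hB⟩
    exacts [hnot 1 hA, hnot z hB]

end IsExtraspecial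

theorem theorem2p8 {p : ℕ} (hp : p.Prime) {G : Type*} [Group G] (hG : IsExtraspecial p G) :
    (Odd p →
      (∀ k : ℕ, 1 ≤ k → Nonempty (G ≃* CentralPower (ModularGroupCube p) k) →
        solutionCounts G =
          {0, 1, 2 ^ p ^ (2 * k + 1) - 1} ∪
            {m | ∃ j : ℕ, 1 ≤ j ∧ j ≤ p ∧ m = (2 ^ p ^ (2 * k) - 1) ^ j}) ∧
      (∀ k : ℕ, 1 ≤ k → Nonempty (G ≃* CentralPower (HeisenbergGroup p) k) →
        solutionCounts G = {0, 1, 2 ^ p ^ (2 * k + 1) - 1}) ∧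
      InClassD G) ∧
    (p = 2 →
      (∃ k : ℕ, 1 ≤ k ∧ Nat.card G = 2 ^ (2 * k + 1) ∧
        solutionCounts G =
          {0, 1, 2 ^ (4 ^ k - 2 ^ k) - 1, 2 ^ (4 ^ k + 2 ^ k) - 1,
            (2 ^ (4 ^ k - 2 ^ k) - 1) * (2 ^ (4 ^ k + 2 ^ k) - 1), 2 ^ 2 ^ (2 * k + 1) - 1}) ∧
      ¬ InClassD G) := by
  have hnc := hG.not_commutative hp
  refine ⟨fun hodd => ⟨fun k hk ⟨e⟩ => ?_, fun k hk ⟨e⟩ => ?_, hG.inClassD_of_odd hp hodd⟩, ?_⟩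
  · obtain ⟨hcard, hpow⟩ := card_and_pow_of_equiv_centralPower_modular hp hodd hk hnc e
    rw [hG.solutionCounts_of_pow_ne_one hp hodd hpow hcard, hcard]
  · obtain ⟨hcard, hpow⟩ := card_and_pow_of_equiv_centralPower_heisenberg hp hodd hk hnc e
    rw [hG.solutionCounts_of_pow_eq_one hp hpow, hcard]
  · rintro rfl
    exact hG.solutionCounts_and_not_inClassD_of_two
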